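/- Let $M$ be a smooth connected manifold, possibly with boundary, of dimension $d\ge 3$ (Hausdorff, second countable, not necessarily compact), and let $z$ be a point in its interior. For $\mathrm{Cat}\in\{\mathrm{Diff},\mathrm{Homeo},\mathrm{hAut}\}$ let $\mathrm{Cat}(M)$ be, respectively, the group of diffeomorphisms of $M$ with the smooth Whitney topology, the group of homeomorphisms of $M$ with the compact-open topology, or the monoid of continuous maps $M\to M$ admitting a homotopy inverse, with the compact-open topology. Let $\mathrm{Cat}(M,z)\subseteq \mathrm{Cat}(M)$ be the subspace of elements fixing $z$, and let $\mathrm{Cat}_\partial(M)\subseteq\mathrm{Cat}(M)$ and $\mathrm{Cat}_\partial(M,z)\subseteq\mathrm{Cat}(M,z)$ be the subspaces of elements that fix $\partial M$ pointwise. The point-pushing map $$p_1\colon \pi_1(M,z)\longrightarrow \pi_0(\mathrm{Cat}(M,z))$$ is the connecting homomorphism of the evaluation $\mathrm{ev}_z\colon\varphi\mapsto\varphi(z)$ on $\mathrm{Cat}(M)$: it sends $[\gamma]$, with $\gamma$ a loop at $z$ in the interior of $M$, to the class of $\Phi_1$, for any path $(\Phi_t)_{t\in[0,1]}$ in $\mathrm{Cat}(M)$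 with $\Phi_0=\mathrm{id}$ and $\Phi_t(z)=\gamma(t)$ for all $t$. The point-pushing map $p_1^{\partial}\colon\pi_1(M,z)\to\pi_0(\mathrm{Cat}_\partial(M,z))$ is defined in the same way with paths in $\mathrm{Cat}_\partial(M)$. (Products in $\pi_0$ are induced by composition, $[\varphi][\psi]=[\varphi\circ\psi]$, and in the product $ab$ in $\pi_1(M,z)$ the loop $b$ is traversed first.) Then, for each of the three choices of $\mathrm{Cat}$: 1. $p_1$ is a well-defined homomorphism, and $\ker(p_1)\subseteq Z(\pi_1(M,z))$, i.e. its kernel is contained in the centre of $\pi_1(M,z)$. 2. If $\partial M\neq\varnothing$, then $p_1^{\partial}$ is a well-defined homomorphism, and it is injective. -/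

import Mathlib

open scoped Manifold ContDiff Topology

noncomputable section

namespace PointPushing

universe u

/-! ### The monoid of path components -/

section PathComponents

variable {G : Type*} [Monoid G] [TopologicalSpace G] [SeparatelyContinuousMul G]

instance submonoid_separatelyContinuousMul (S : Submonoid G) : SeparatelyContinuousMul S where
  continuous_const_mul {a} :=
    Continuous.subtype_mk (continuous_const_mul (a : G) |>.comp continuous_subtype_val) _
  continuous_mul_const {a} :=
    Continuous.subtype_mk (continuous_mul_const (a : G) |>.comp continuous_subtype_val) _

theorem joined_mul {a b c d : G} (h : Joined a b) (k : Joined c d) : Joined (a * c) (b * d) := by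
  obtain ⟨p⟩ := h
  obtain ⟨q⟩ := k
  exact ⟨(p.map (continuous_mul_const c)).trans (q.map (continuous_const_mul b))⟩

/-- The set `π₀(G)` of path components of a monoid with separately continuous multiplication is a
monoid, with `[a] * [b] = [a * b]`. -/
instance zerothHomotopyMonoid : Monoid (ZerothHomotopy G) where
  mul := Quotient.map₂ (· * ·) fun _ _ h _ _ k => joined_mul h k
  one := ZerothHomotopy.mk 1
  mul_assoc := by
    rintro ⟨a⟩ ⟨b⟩ ⟨c⟩
    exact congrArg ZerothHomotopy.mk (mul_assoc a b c)
  one_mul := by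
    rintro ⟨a⟩
    exact congrArg ZerothHomotopy.mk (one_mul a)
  mul_one := by
    rintro ⟨a⟩
    exact congrArg ZerothHomotopy.mk (mul_one a)

end PathComponents

/-! ### Homeomorphisms -/

section Homeo

variable {M : Type u} [TopologicalSpace M]

/-- The compact-open topology on the group of homeomorphisms. -/
instance homeoTopology : TopologicalSpace (M ≃ₜ M) :=
  TopologicalSpace.induced (fun φ => (⟨φ, φ.continuous⟩ : C(M, M))) inferInstance

/-- A homeomorphism acts on points by evaluation. -/
instance homeoAction : MulAction (M ≃ₜ M) M where
  smul φ x := φ x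
  one_smul _ := rfl
  mul_smul _ _ _ := rfl

instance homeo_separatelyContinuousMul : SeparatelyContinuousMul (M ≃ₜ M) where
  continuous_const_mul {φ} := continuous_induced_rng.2
    ((ContinuousMap.continuous_postcomp (⟨φ, φ.continuous⟩ : C(M, M))).comp
      (continuous_induced_dom (f := fun ψ : M ≃ₜ M => (⟨ψ, ψ.continuous⟩ : C(M, M)))))
  continuous_mul_const {φ} := continuous_induced_rng.2
    ((ContinuousMap.continuous_precomp (⟨φ, φ.continuous⟩ : C(M, M))).comp
      (continuous_induced_dom (f := fun ψ : M ≃ₜ M => (⟨ψ, ψ.continuous⟩ : C(M, M)))))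

end Homeo

/-! ### Homotopy automorphisms -/

section HAut

variable (M : Type u) [TopologicalSpace M]

/-- The space `hAut(M)` of continuous self-maps of `M` that admit a homotopy inverse, with the
compact-open topology. -/
def HAut : Type u :=
  {f : C(M, M) // ∃ g : C(M, M),
    (g.comp f).Homotopic (ContinuousMap.id M) ∧ (f.comp g).Homotopic (ContinuousMap.id M)}

instance hAutTopology : TopologicalSpace (HAut M) :=
  inferInstanceAs (TopologicalSpace {f : C(M, M) // ∃ g : C(M, M),
    (g.comp f).Homotopic (ContinuousMap.id M) ∧ (f.comp g).Homotopic (ContinuousMap.id M)})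

variable {M}

theorem hAut_comp {f₁ f₂ g₁ g₂ : C(M, M)}
    (h₁ : (g₁.comp f₁).Homotopic (ContinuousMap.id M))
    (h₂ : (g₂.comp f₂).Homotopic (ContinuousMap.id M)) :
    ((g₂.comp g₁).comp (f₁.comp f₂)).Homotopic (ContinuousMap.id M) :=
  ((ContinuousMap.Homotopic.refl g₂).comp (h₁.comp (ContinuousMap.Homotopic.refl f₂))).trans h₂

/-- Composition of self-maps: `(f * g) x = f (g x)`. -/
instance hAutMonoid : Monoid (HAut M) where
  mul f g := ⟨f.1.comp g.1, by
    obtain ⟨f', hf, hf'⟩ := f.2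
    obtain ⟨g', hg, hg'⟩ := g.2
    exact ⟨g'.comp f', hAut_comp hf hg, hAut_comp hg' hf'⟩⟩
  one := ⟨ContinuousMap.id M, ContinuousMap.id M, .refl _, .refl _⟩
  mul_assoc _ _ _ := rfl
  one_mul _ := rfl
  mul_one _ := rfl

/-- A homotopy automorphism acts on points by evaluation. -/
instance hAutAction : MulAction (HAut M) M where
  smul f x := f.1 x
  one_smul _ := rfl
  mul_smul _ _ _ := rfl

instance hAut_separatelyContinuousMul : SeparatelyContinuousMul (HAut M) where
  continuous_const_mul {f} := Continuous.subtype_mk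
    ((ContinuousMap.continuous_postcomp f.1).comp continuous_subtype_val) _
  continuous_mul_const {f} := Continuous.subtype_mk
    ((ContinuousMap.continuous_precomp f.1).comp continuous_subtype_val) _

end HAut

/-! ### Diffeomorphisms, with the smooth Whitney topology -/

section Diff

/-- A smooth manifold (possibly with boundary or corners) together with a map to `M`. It serves to
carry the iterated tangent bundles of `M`, with their projections. -/
structure MfdOver (M : Type u) where
  E : Type
  [normed : NormedAddCommGroup E]
  [space : NormedSpace ℝ E]
  H : Type
  [topH : TopologicalSpace H]
  I : ModelWithCorners ℝ E H
  X : Type u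
  [topX : TopologicalSpace X]
  [charted : ChartedSpace H X]
  [smooth : IsManifold I ∞ X]
  proj : X → M

attribute [instance] MfdOver.normed MfdOver.space MfdOver.topH MfdOver.topX MfdOver.charted
  MfdOver.smooth

/-- The tangent bundle, with the projection to `M` through the base. -/
def MfdOver.tangent {M : Type u} (S : MfdOver M) : MfdOver M where
  E := S.E × S.E
  H := ModelProd S.H S.E
  I := S.I.tangent
  X := TangentBundle S.I S.X
  smooth := Bundle.TotalSpace.isManifold S.E (TangentSpace S.I : S.X → Type)
  proj v := S.proj v.proj

variable {E : Type} [NormedAddCommGroup E] [NormedSpace ℝ E] {H : Type} [TopologicalSpace H]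
  (I : ModelWithCorners ℝ E H) (M : Type u) [TopologicalSpace M] [ChartedSpace H M]
  [IsManifold I ∞ M]

/-- The `k`-fold iterated tangent bundle `TᵏM`, with its projection to `M`. -/
def iterTangent : ℕ → MfdOver M
  | 0 => { E := E, H := H, I := I, X := M, proj := id }
  | k + 1 => (iterTangent k).tangent

variable {M}

/-- The `k`-fold iterated tangent map `Tᵏf : TᵏM → TᵏM` of a self-map `f` of `M`. In charts, its
components are built from the partial derivatives of `f` of order at most `k`. -/
def iterTangentMap (f : M → M) : ∀ k : ℕ, (iterTangent I M k).X → (iterTangent I M k).X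
  | 0 => f
  | k + 1 => tangentMap (iterTangent I M k).I (iterTangent I M k).I (iterTangentMap f k)

/-- The set of diffeomorphisms `φ` with `Tᵏφ(L i) ⊆ W i` for all `i`. -/
def whitneySet (k : ℕ) (L W : ℕ → Set (iterTangent I M k).X) : Set (M ≃ₘ⟮I, I⟯ M) :=
  {φ | ∀ i, Set.MapsTo (iterTangentMap I φ k) (L i) (W i)}

/-- The smooth Whitney (strong `C^∞`) topology on the group of diffeomorphisms: it is generated by
the conditions `Tᵏφ(L i) ⊆ W i` for all `i`, where `k` is any order of derivatives, the `L i` are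
compact sets of `k`-fold tangent vectors lying over a locally finite family of subsets of `M`, and
the `W i` are open. So it controls derivatives of every finite order, uniformly on the members of
locally finite families of compact sets. -/
instance diffTopology : TopologicalSpace (M ≃ₘ⟮I, I⟯ M) :=
  TopologicalSpace.generateFrom
    {U | ∃ (k : ℕ) (L W : ℕ → Set (iterTangent I M k).X),
      (∀ i, IsCompact (L i)) ∧ (LocallyFinite fun i => (iterTangent I M k).proj '' L i) ∧
      (∀ i, IsOpen (W i)) ∧ U = whitneySet I k L W}

theorem contMDiff_iterTangentMap {f : M → M} (hf : ContMDiff I I ∞ f) (k : ℕ) :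
    ContMDiff (iterTangent I M k).I (iterTangent I M k).I ∞ (iterTangentMap I f k) := by
  induction k with
  | zero => exact hf
  | succ k ih => exact ih.contMDiff_tangentMap (m := ∞) le_rfl

theorem iterTangentMap_comp {f g : M → M} (hf : ContMDiff I I ∞ f) (hg : ContMDiff I I ∞ g)
    (k : ℕ) : iterTangentMap I (f ∘ g) k = iterTangentMap I f k ∘ iterTangentMap I g k := by
  induction k with
  | zero => rfl
  | succ k ih =>
    change tangentMap _ _ (iterTangentMap I (f ∘ g) k) = _
    rw [ih]
    exact tangentMap_comp ((contMDiff_iterTangentMap I hf k).mdifferentiable (by simp))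
      ((contMDiff_iterTangentMap I hg k).mdifferentiable (by simp))

theorem proj_iterTangentMap (f : M → M) (k : ℕ) (v : (iterTangent I M k).X) :
    (iterTangent I M k).proj (iterTangentMap I f k v) = f ((iterTangent I M k).proj v) := by
  induction k with
  | zero => rfl
  | succ k ih => exact ih v.proj

/-- Composition of diffeomorphisms: `(φ * ψ) x = φ (ψ x)`. -/
instance diffGroup : Group (M ≃ₘ⟮I, I⟯ M) where
  mul φ ψ := ψ.trans φ
  one := Diffeomorph.refl I M ∞
  inv φ := φ.symm
  mul_assoc _ _ _ := rfl
  one_mul _ := rfl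
  mul_one _ := rfl
  inv_mul_cancel φ := φ.self_trans_symm

/-- A diffeomorphism acts on points by evaluation. -/
instance diffAction : MulAction (M ≃ₘ⟮I, I⟯ M) M where
  smul φ x := φ x
  one_smul _ := rfl
  mul_smul _ _ _ := rfl

instance diff_separatelyContinuousMul : SeparatelyContinuousMul (M ≃ₘ⟮I, I⟯ M) where
  continuous_const_mul {φ} := by
    refine continuous_generateFrom_iff.2 ?_
    rintro _ ⟨k, L, W, hL, hfin, hW, rfl⟩
    refine TopologicalSpace.isOpen_generateFrom_of_mem
      ⟨k, L, fun i => iterTangentMap I φ k ⁻¹' W i, hL, hfin,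
        fun i => (hW i).preimage (contMDiff_iterTangentMap I φ.contMDiff k).continuous, ?_⟩
    ext ψ
    have h : iterTangentMap I (φ * ψ : M ≃ₘ⟮I, I⟯ M) k
        = iterTangentMap I φ k ∘ iterTangentMap I ψ k :=
      iterTangentMap_comp I φ.contMDiff ψ.contMDiff k
    simp only [whitneySet, Set.mem_preimage, Set.mem_ofPred_eq, h]
    rfl
  continuous_mul_const {φ} := by
    refine continuous_generateFrom_iff.2 ?_
    rintro _ ⟨k, L, W, hL, hfin, hW, rfl⟩
    refine TopologicalSpace.isOpen_generateFrom_of_mem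
      ⟨k, fun i => iterTangentMap I φ k '' L i, W,
        fun i => (hL i).image (contMDiff_iterTangentMap I φ.contMDiff k).continuous, ?_, hW, ?_⟩
    · have h : (fun i => (iterTangent I M k).proj '' (iterTangentMap I φ k '' L i))
          = fun i => φ.symm ⁻¹' ((iterTangent I M k).proj '' L i) := by
        funext i
        have e : φ.symm ⁻¹' ((iterTangent I M k).proj '' L i)
            = φ '' ((iterTangent I M k).proj '' L i) :=
          (φ.toEquiv.image_eq_preimage_symm _).symm
        rw [e, Set.image_image, Set.image_image]
        simp only [proj_iterTangentMap]
      rw [h]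
      exact hfin.preimage_continuous φ.symm.continuous
    · ext ψ
      have h : iterTangentMap I (ψ * φ : M ≃ₘ⟮I, I⟯ M) k
          = iterTangentMap I ψ k ∘ iterTangentMap I φ k :=
        iterTangentMap_comp I ψ.contMDiff φ.contMDiff k
      simp only [whitneySet, Set.mem_preimage, Set.mem_ofPred_eq, h]
      simp only [Set.mapsTo_image_iff]

end Diff

/-! ### Automorphisms relative to a subset, and the point-pushing map -/

section PointPush

variable {E : Type} [NormedAddCommGroup E] [NormedSpace ℝ E] {H : Type} [TopologicalSpace H]
  (I : ModelWithCorners ℝ E H) {M : Type u} [TopologicalSpace M] [ChartedSpace H M]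
  (G : Type u) [Monoid G] [TopologicalSpace G] [SeparatelyContinuousMul G] [MulAction G M]

/-- The automorphisms in `G` that fix every point of `A`, with the subspace topology. With `G` the
diffeomorphisms, homeomorphisms or homotopy automorphisms of `M`, this is `Cat(M)` for `A = ∅`,
`Cat_∂(M)` for `A = ∂M`, `Cat(M, z)` for `A = {z}` and `Cat_∂(M, z)` for `A = ∂M ∪ {z}`. -/
abbrev AutFixing (A : Set M) : Type u := fixingSubmonoid G A

/-- `a ∈ π₁(M, z)` is represented by a loop `γ` in the interior of `M` which lifts along the
evaluation map `φ ↦ φ(z)` to a path in the space of automorphisms fixing `A`, starting at the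
identity and ending at an automorphism `ψ`. This `ψ` also fixes `z`, and `c` is the class of `ψ` in
`π₀` of the space of automorphisms fixing `A ∪ {z}`. -/
def IsPush (A : Set M) (z : M) (a : FundamentalGroup M z)
    (c : ZerothHomotopy (AutFixing G (A ∪ {z}))) : Prop :=
  ∃ (γ : Path z z) (Φ : C(unitInterval, AutFixing G A)) (ψ : AutFixing G (A ∪ {z})),
    (∀ t, γ t ∈ I.interior M) ∧
    FundamentalGroup.fromPath (Path.Homotopic.Quotient.mk γ) = a ∧
    Φ 0 = 1 ∧
    (∀ t, (Φ t : G) • z = γ t) ∧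
    (Φ 1 : G) = ψ ∧
    ZerothHomotopy.mk ψ = c

/-- `p` is the point-pushing homomorphism, i.e. the connecting homomorphism
`π₁(M, z) → π₀(automorphisms fixing A ∪ {z})` of the evaluation map
`φ ↦ φ(z)` on automorphisms fixing `A`: every class in `π₁(M, z)` has a push, and `p` maps it
to that push and to no other. At most one `p` has this property. -/
def IsPointPushingMap (A : Set M) (z : M)
    (p : FundamentalGroup M z →* ZerothHomotopy (AutFixing G (A ∪ {z}))) : Prop :=
  ∀ a c, p a = c ↔ IsPush I G A z a c

/-- For the automorphisms `G` of `M`: the point-pushing homomorphism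
`π₁(M, z) → π₀(Cat(M, z))` exists, and its kernel is contained in the centre of `π₁(M, z)`. -/
def KernelCentral (z : M) : Prop :=
  ∃ p : FundamentalGroup M z →* ZerothHomotopy (AutFixing G (∅ ∪ {z})),
    IsPointPushingMap I G ∅ z p ∧ p.ker ≤ Subgroup.center (FundamentalGroup M z)

/-- For the automorphisms `G` of `M`: the point-pushing homomorphism
`π₁(M, z) → π₀(Cat_∂(M, z))` exists, and it is injective. -/
def BoundaryInjective (z : M) : Prop :=
  ∃ p : FundamentalGroup M z →* ZerothHomotopy (AutFixing G (I.boundary M ∪ {z})),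
    IsPointPushingMap I G (I.boundary M) z p ∧ Function.Injective p

end PointPush

end PointPushing

end

open scoped Manifold ContDiff Topology

noncomputable section

namespace PointPushing

universe u

/-! Everything rests on homotopy lifting for the evaluation map `φ ↦ φ • z` over the interior of
`M`. Near an interior point, compactly supported diffeomorphisms `s y y'` move `y` to `y'`
continuously and fix the boundary (`exists_push_family`). Left multiplication by them corrects a
path of automorphisms over one small piece of a homotopy at a time (`HasLocalPush.exists_lift`). No
automorphism is ever inverted, so the argument covers the monoid `HAut M` too.

Loops and homotopies in `M` may touch the boundary, where nothing can be pushed; an inward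
deformation of compact sets moves them into the interior (`IsCompact.pushable`). Lifting then gives
existence and uniqueness of pushes, hence the homomorphism.

If the push along `a` is trivial, closing up the lift gives a homotopy `F` from the identity of `M`
to itself under which `z` traces `a`. For a path `p` from `x` to `y`, naturality of `F` shows that
`p` followed by the trace of `y` is homotopic to the trace of `x` followed by `p`. With `p` a loop
at `z`, this says that `a` is central. In the relative case take `p` from a boundary point, whose
trace is constant; cancelling `p` gives `a = 1`. -/

/-! ### Lifting homotopies along the evaluation map -/

section Lifting

variable {M : Type u} [TopologicalSpace M] {N : Type u} [Monoid N] [TopologicalSpace N]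
  [MulAction N M]

/-- Near every point of `V`, the monoid `N` contains a continuous family of elements `s y y'` that
move `y` to `y'`, and `s y y = 1`. -/
def HasLocalPush (N : Type u) [Monoid N] [TopologicalSpace N] [MulAction N M] (V : Set M) : Prop :=
  ∀ x ∈ V, ∃ U ∈ 𝓝 x, ∃ s : M → M → N, (∀ y ∈ U, s y y = 1) ∧
    (∀ y ∈ U, ∀ y' ∈ U, s y y' • y = y') ∧
    -- Multiplication is only separately continuous in the applications, so continuity of `s` alone
    -- would not make the corrected lifts continuous.
    ContinuousOn (fun q : (M × M) × N => s q.1.1 q.1.2 * q.2) ((U ×ˢ U) ×ˢ Set.univ)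

/-- Multiply `Φ t` by `s (γ t) (γ' t)` where `h t ≤ 1` and leave it alone elsewhere. The two
formulas agree on `h t = 1`, since there `γ t = γ' t` and `s y y = 1`. -/
theorem exists_lift_modify {X : Type*} [TopologicalSpace X] {U : Set M} {s : M → M → N}
    (hs₁ : ∀ y ∈ U, s y y = 1) (hs : ∀ y ∈ U, ∀ y' ∈ U, s y y' • y = y')
    (hsc : ContinuousOn (fun q : (M × M) × N => s q.1.1 q.1.2 * q.2) ((U ×ˢ U) ×ˢ Set.univ))
    {z : M} (Φ : C(X, N)) (γ γ' : C(X, M)) (h : C(X, ℝ))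
    (hU : ∀ t, h t ≤ 1 → γ t ∈ U ∧ γ' t ∈ U) (hout : ∀ t, 1 ≤ h t → γ t = γ' t)
    (hΦ : ∀ t, Φ t • z = γ t) :
    ∃ Φ' : C(X, N), (∀ t, Φ' t • z = γ' t) ∧ ∀ t, γ t = γ' t → Φ' t = Φ t := by
  classical
  refine ⟨⟨fun t => if h t ≤ 1 then s (γ t) (γ' t) * Φ t else Φ t, ?_⟩, fun t => ?_,
    fun t ht => ?_⟩
  · refine continuous_if_le h.continuous continuous_const ?_ Φ.continuous.continuousOn ?_
    · exact hsc.comp (f := fun t => ((γ t, γ' t), Φ t)) (by fun_prop)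
        fun t ht => ⟨⟨(hU t ht).1, (hU t ht).2⟩, trivial⟩
    · intro t ht
      rw [← hout t ht.ge, hs₁ _ (hU t ht.le).1, one_mul]
  · by_cases ht : h t ≤ 1
    · simp only [ContinuousMap.coe_mk, if_pos ht, mul_smul, hΦ]
      exact hs _ (hU t ht).1 _ (hU t ht).2
    · simp only [ContinuousMap.coe_mk, if_neg ht, hΦ]
      exact hout t (not_le.1 ht).le
  · by_cases h1 : h t ≤ 1
    · simp only [ContinuousMap.coe_mk, if_pos h1, ← ht, hs₁ _ (hU t h1).1, one_mul]
    · simp only [ContinuousMap.coe_mk, if_neg h1]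

/-- The continuous function `t ↦ (i + c) / n`, where `c` is the truncation of `k - n t` to the unit
interval. It interpolates from `i / n` at `k = 0` to `(i + 1) / n` at `k = n + 1`. -/
def sweep (n i k : ℕ) : C(unitInterval, unitInterval) where
  toFun t := Set.projIcc 0 1 zero_le_one ((i + max 0 (min 1 (k - n * (t : ℝ)))) / n)
  continuous_toFun := by fun_prop

/-- Outside the window `|n t - k| < 1` both truncations are 0 or both are 1, so one step changes the
path only within a short time interval. -/
theorem sweep_eq_of_le {n i k : ℕ} {t : unitInterval} (h : 1 ≤ |n * (t : ℝ) - k|) :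
    sweep n i k t = sweep n i (k + 1) t := by
  have : max 0 (min 1 (k - n * (t : ℝ))) = max 0 (min 1 (((k + 1 : ℕ) : ℝ) - n * (t : ℝ))) := by
    push_cast
    rcases le_abs.1 h with h | h
    · rw [max_eq_left (min_le_of_right_le (by linarith)),
        max_eq_left (min_le_of_right_le (by linarith))]
    · rw [min_eq_left (by linarith), min_eq_left (by linarith)]
  simp only [sweep, ContinuousMap.coe_mk, this]

theorem dist_sweep_le {n i k : ℕ} (hn : 0 < n) (t : unitInterval) :
    dist (sweep n i k t) (Set.projIcc 0 1 zero_le_one ((i : ℝ) / n)) ≤ 1 / n := by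
  have hn' : (0 : ℝ) < n := by exact_mod_cast hn
  have h0 : (0 : ℝ) ≤ max 0 (min 1 (k - n * (t : ℝ))) := le_max_left _ _
  have h1 : max 0 (min 1 (k - n * (t : ℝ))) ≤ 1 := max_le zero_le_one (min_le_left _ _)
  refine (Set.abs_projIcc_sub_projIcc (a := (0 : ℝ)) (b := 1) zero_le_one).trans ?_
  rw [← sub_div, add_sub_cancel_left, abs_div, abs_of_nonneg h0, abs_of_pos hn']
  gcongr

theorem sweep_zero (n i : ℕ) (t : unitInterval) :
    sweep n i 0 t = Set.projIcc 0 1 zero_le_one ((i : ℝ) / n) := by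
  have : (0 : ℝ) ≤ n * (t : ℝ) := mul_nonneg n.cast_nonneg t.2.1
  simp only [sweep, ContinuousMap.coe_mk]
  rw [max_eq_left (min_le_of_right_le (by push_cast; linarith)), add_zero]

/-- The index `n + 1` is needed: at `k = n` the truncation still vanishes at `t = 1`. -/
theorem sweep_last (n i : ℕ) (t : unitInterval) :
    sweep n i (n + 1) t = sweep n (i + 1) 0 t := by
  rw [sweep_zero]
  have : n * (t : ℝ) ≤ n * 1 := by gcongr; exact t.2.2
  simp only [sweep, ContinuousMap.coe_mk]
  rw [min_eq_left (by push_cast; linarith), max_eq_right zero_le_one]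
  push_cast
  rfl

/-- Homotopy lifting along the evaluation map at `z`, for homotopies of paths. The lift is unchanged
where the homotopy is constant. -/
theorem HasLocalPush.exists_lift {V : Set M} (hN : HasLocalPush N V) {z : M}
    (F : C(unitInterval × unitInterval, M)) (hF : ∀ q, F q ∈ V) (Φ : C(unitInterval, N))
    (hΦ : ∀ t, Φ t • z = F (0, t)) :
    ∃ Φ' : C(unitInterval, N), (∀ t, Φ' t • z = F (1, t)) ∧
      ∀ t, (∀ r, F (r, t) = F (0, t)) → Φ' t = Φ t := by
  choose U hU s hs₁ hs hsc using hN
  obtain ⟨δ, hδ, hball⟩ := lebesgue_number_lemma_of_metric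
    (c := fun q : unitInterval × unitInterval => F ⁻¹' interior (U (F q) (hF q)))
    isCompact_univ (fun q => isOpen_interior.preimage F.continuous)
    (fun q _ => Set.mem_iUnion.2 ⟨q, mem_interior_iff_mem_nhds.2 (hU _ _)⟩)
  -- With `1 / n < δ`, the part of the square changed in one step lies within `δ` of the grid point
  -- `(i / n, k / n)`, so `F` maps it into a single `U`.
  obtain ⟨n, hn⟩ := exists_nat_gt (1 / δ)
  have hn0 : (0 : ℝ) < n := (one_div_pos.2 hδ).trans hn
  have hnδ : 1 / (n : ℝ) < δ := by rwa [one_div_lt hn0 hδ]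
  let P (ρ : C(unitInterval, unitInterval)) : Prop :=
    ∃ Φ' : C(unitInterval, N), (∀ t, Φ' t • z = F (ρ t, t)) ∧
      ∀ t, (∀ r, F (r, t) = F (0, t)) → Φ' t = Φ t
  have congr {ρ ρ' : C(unitInterval, unitInterval)} (h : ∀ t, ρ t = ρ' t) : P ρ → P ρ' := by
    rw [ContinuousMap.ext h]
    exact id
  have step (i k : ℕ) (hk : k ≤ n) (h : P (sweep n i k)) : P (sweep n i (k + 1)) := by
    obtain ⟨Ψ, hΨ, hΨ'⟩ := h
    obtain ⟨q, hq⟩ := hball (Set.projIcc 0 1 zero_le_one ((i : ℝ) / n),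
      Set.projIcc 0 1 zero_le_one ((k : ℝ) / n)) trivial
    have key (l : ℕ) (t : unitInterval) (ht : |n * (t : ℝ) - k| ≤ 1) :
        F (sweep n i l t, t) ∈ U (F q) (hF q) := by
      refine interior_subset (hq ?_)
      rw [Metric.mem_ball, Prod.dist_eq]
      refine max_lt ((dist_sweep_le (by exact_mod_cast hn0) t).trans_lt hnδ) ?_
      refine lt_of_le_of_lt ?_ hnδ
      have hk1 : (k : ℝ) / n ≤ 1 := by rw [div_le_one hn0]; exact_mod_cast hk
      rw [Set.projIcc_of_mem _ (show (k : ℝ) / n ∈ Set.Icc (0 : ℝ) 1 from ⟨by positivity, hk1⟩),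
        Subtype.dist_eq, Real.dist_eq]
      have : (t : ℝ) - k / n = (n * t - k) / n := by field_simp
      rw [this, abs_div, abs_of_pos hn0]
      gcongr
    obtain ⟨Ψ', h1, h2⟩ := exists_lift_modify (hs₁ _ (hF q)) (hs _ (hF q)) (hsc _ (hF q)) Ψ
      (F.comp ((sweep n i k).prodMk (.id _))) (F.comp ((sweep n i (k + 1)).prodMk (.id _)))
      ⟨fun t => |n * (t : ℝ) - k|, by fun_prop⟩ (fun t ht => ⟨key k t ht, key (k + 1) t ht⟩)
      (fun t ht => by
        change F (sweep n i k t, t) = F (sweep n i (k + 1) t, t)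
        rw [sweep_eq_of_le ht]) hΨ
    refine ⟨Ψ', h1, fun t ht => (h2 t ?_).trans (hΨ' t ht)⟩
    exact (ht _).trans (ht _).symm
  have sweepAll (i : ℕ) (h : P (sweep n i 0)) : P (sweep n (i + 1) 0) := by
    refine congr (sweep_last n i) ?_
    have (k : ℕ) (hk : k ≤ n + 1) : P (sweep n i k) := by
      induction k with
      | zero => exact h
      | succ k ih => exact step i k (by omega) (ih (by omega))
    exact this _ le_rfl
  have all (i : ℕ) (hi : i ≤ n) : P (sweep n i 0) := by
    induction i with
    | zero =>
      refine ⟨Φ, fun t => ?_, fun _ _ => rfl⟩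
      rw [hΦ, sweep_zero]
      simp
    | succ i ih => exact sweepAll i (ih (by omega))
  obtain ⟨Φ', h1, h2⟩ := all n le_rfl
  refine ⟨Φ', fun t => ?_, h2⟩
  rw [h1, sweep_zero, div_self hn0.ne']
  simp

end Lifting

/-! ### Extending maps of a chart by the identity -/

section ChartExtend

variable {E : Type} [NormedAddCommGroup E] [NormedSpace ℝ E] {H : Type} [TopologicalSpace H]
  (I : ModelWithCorners ℝ E H) {M : Type u} [TopologicalSpace M] [ChartedSpace H M]

open Classical in
/-- The self-map of `M` that is given by `f` in the chart at `x`, and by the identity outside. -/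
def chartExtend (x : M) (f : E → E) (y : M) : M :=
  if y ∈ (extChartAt I x).source then (extChartAt I x).symm (f (extChartAt I x y)) else y

variable {I} {x : M} {f g : E → E} {K : Set E}

theorem chartExtend_of_mem {y : M} (hy : y ∈ (extChartAt I x).source) :
    chartExtend I x f y = (extChartAt I x).symm (f (extChartAt I x y)) := if_pos hy

theorem chartExtend_of_eq {y : M}
    (hy : y ∈ (extChartAt I x).source → f (extChartAt I x y) = extChartAt I x y) :
    chartExtend I x f y = y := by
  by_cases h : y ∈ (extChartAt I x).source
  · rw [chartExtend_of_mem h, hy h, (extChartAt I x).left_inv h]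
  · exact if_neg h

theorem chartExtend_of_notMem (hf : ∀ v ∈ (extChartAt I x).target, v ∉ K → f v = v) {y : M}
    (hy : y ∉ (extChartAt I x).symm '' K) : chartExtend I x f y = y :=
  chartExtend_of_eq fun h => hf _ ((extChartAt I x).map_source h) fun hK =>
    hy ⟨_, hK, (extChartAt I x).left_inv h⟩

theorem isCompact_extChartAt_symm_image (hK : IsCompact K) (hKt : K ⊆ (extChartAt I x).target) :
    IsCompact ((extChartAt I x).symm '' K) :=
  hK.image_of_continuousOn ((continuousOn_extChartAt_symm x).mono hKt)

theorem chartExtend_comp (hg : Set.MapsTo g (extChartAt I x).target (extChartAt I x).target)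
    (y : M) : chartExtend I x f (chartExtend I x g y) = chartExtend I x (f ∘ g) y := by
  by_cases h : y ∈ (extChartAt I x).source
  · have h' := hg ((extChartAt I x).map_source h)
    rw [chartExtend_of_mem h, chartExtend_of_mem ((extChartAt I x).map_target h'),
      (extChartAt I x).right_inv h', chartExtend_of_mem h]
    rfl
  · have e (k : E → E) : chartExtend I x k y = y := if_neg h
    rw [e g, e f, e]

/-- On the open chart domain the map is a composite of continuous maps. The image of `K` is compact,
hence closed in the Hausdorff space `M`, so near a point outside the domain the map is the identity.
-/
theorem continuous_chartExtend [T2Space M] {P : Type*} [TopologicalSpace P] {f : P → E → E}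
    (hfc : Continuous fun q : P × E => f q.1 q.2) (hK : IsCompact K)
    (hKt : K ⊆ (extChartAt I x).target) (hf : ∀ p, ∀ v ∈ (extChartAt I x).target, v ∉ K → f p v = v)
    (hft : ∀ p, Set.MapsTo (f p) (extChartAt I x).target (extChartAt I x).target) :
    Continuous fun q : P × M => chartExtend I x (f q.1) q.2 := by
  refine continuous_iff_continuousAt.2 fun ⟨p, y⟩ => ?_
  by_cases hy : y ∈ (extChartAt I x).source
  · have h : ContinuousOn (fun q : P × M => (extChartAt I x).symm (f q.1 (extChartAt I x q.2)))
        (Set.univ ×ˢ (extChartAt I x).source) := by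
      refine (continuousOn_extChartAt_symm x).comp (hfc.comp_continuousOn
        (continuousOn_fst.prodMk ((continuousOn_extChartAt x).comp continuousOn_snd
          fun q hq => hq.2))) fun q hq => hft _ ((extChartAt I x).map_source hq.2)
    have hn : Set.univ ×ˢ (extChartAt I x).source ∈ 𝓝 (p, y) :=
      (isOpen_univ.prod (isOpen_extChartAt_source x)).mem_nhds ⟨trivial, hy⟩
    refine (h.continuousAt hn).congr ?_
    filter_upwards [hn] with q hq
    exact (chartExtend_of_mem hq.2).symm
  · have hn : (Prod.snd ⁻¹' ((extChartAt I x).symm '' K)ᶜ : Set (P × M)) ∈ 𝓝 (p, y) := by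
      refine ((isCompact_extChartAt_symm_image hK hKt).isClosed.isOpen_compl.preimage
        continuous_snd).mem_nhds ?_
      rintro ⟨v, hv, hvy⟩
      have := (extChartAt I x).map_target (hKt hv)
      rw [hvy] at this
      exact hy this
    refine continuousAt_snd.congr ?_
    filter_upwards [hn] with q hq
    exact (chartExtend_of_notMem (hf _) hq).symm

end ChartExtend

/-! ### Pushing compact sets into the interior -/

section InteriorPush

variable {d : ℕ} [NeZero d] {M : Type u} [TopologicalSpace M]
  [ChartedSpace (EuclideanHalfSpace d) M]

/-- There is a deformation of the identity of `M` that fixes `z`, maps each point to itself or into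
the interior, and ends by mapping `S` into the interior. -/
def Pushable (d : ℕ) [NeZero d] [ChartedSpace (EuclideanHalfSpace d) M] (z : M) (S : Set M) :
    Prop :=
  ∃ H : C(unitInterval × M, M), (∀ y, H (0, y) = y) ∧ (∀ t, H (t, z) = z) ∧
    (∀ t y, H (t, y) = y ∨ H (t, y) ∈ (𝓡∂ d).interior M) ∧
    ∀ y ∈ S, H (1, y) ∈ (𝓡∂ d).interior M

/-- Compose the two deformations. A point already moved into the interior stays there, because each
deformation fixes a point or sends it to the interior. -/
theorem Pushable.union {z : M} {S T : Set M} (hS : Pushable d z S) (hT : Pushable d z T) :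
    Pushable d z (S ∪ T) := by
  obtain ⟨F, hF0, hFz, hF, hFS⟩ := hS
  obtain ⟨G, hG0, hGz, hG, hGT⟩ := hT
  have key (t y) (h : F (t, y) ∈ (𝓡∂ d).interior M) : G (t, F (t, y)) ∈ (𝓡∂ d).interior M := by
    rcases hG t (F (t, y)) with h' | h'
    · rwa [h']
    · exact h'
  refine ⟨⟨fun q => G (q.1, F q), by fun_prop⟩, fun y => ?_, fun t => ?_, fun t y => ?_,
    fun y hy => ?_⟩
  · simp only [ContinuousMap.coe_mk, hF0, hG0]
  · simp only [ContinuousMap.coe_mk, hFz, hGz]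
  · rcases hF t y with h | h
    · simp only [ContinuousMap.coe_mk, h]
      exact hG t y
    · exact .inr (key t y h)
  · rcases hy with hy | hy
    · exact key 1 y (hFS y hy)
    · rcases hF 1 y with h | h
      · simp only [ContinuousMap.coe_mk, h]
        exact hGT y hy
      · exact key 1 y h

variable [IsManifold (𝓡∂ d) ∞ M]

/-- Smoothness of the atlas lets interior points be recognised in any chart, here the one at `x`. -/
theorem extChartAt_symm_mem_interior {x : M} {v : EuclideanSpace ℝ (Fin d)}
    (hv : v ∈ (extChartAt (𝓡∂ d) x).target) (h : 0 < v 0) :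
    (extChartAt (𝓡∂ d) x).symm v ∈ (𝓡∂ d).interior M := by
  have hs := (extChartAt (𝓡∂ d) x).map_target hv
  rw [extChartAt_source] at hs
  refine ((𝓡∂ d).isInteriorPoint_iff_of_mem_atlas (n := ∞) (by simp) (chart_mem_atlas _ x) hs).2 ?_
  change extChartAt (𝓡∂ d) x _ ∈ interior (extChartAt (𝓡∂ d) x).target
  rw [(extChartAt (𝓡∂ d) x).right_inv hv, extChartAt_target, interior_inter,
    ((chartAt _ x).open_target.preimage (𝓡∂ d).continuous_symm).interior_eq,
    interior_range_modelWithCornersEuclideanHalfSpace]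
  rw [extChartAt_target] at hv
  exact ⟨hv.1, h⟩

/-- At a boundary point, push along the inward coordinate direction of a half-space chart, cut off
by a bump function whose support misses `z`. At an interior point the constant deformation works. -/
theorem exists_pushable_nhds [T2Space M] {z : M} (hz : z ∈ (𝓡∂ d).interior M) (x : M) :
    ∃ S ∈ 𝓝 x, Pushable d z S := by
  by_cases hx : x ∈ (𝓡∂ d).interior M
  · exact ⟨_, ((𝓡∂ d).isOpen_interior (n := ∞) (by simp)).mem_nhds hx,
      ⟨⟨Prod.snd, continuous_snd⟩, fun _ => rfl, fun _ => rfl, fun _ _ => .inl rfl, fun _ h => h⟩⟩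
  set ψ := extChartAt (𝓡∂ d) x with hψ
  have hxz : z ∈ ψ.source → ψ x ≠ ψ z := fun h e => by
    rw [← ψ.injOn (mem_extChartAt_source x) h e] at hz
    exact hx hz
  have hU : {v | v ∈ Set.range (𝓡∂ d) → v ∈ ψ.target} ∩ {v | z ∈ ψ.source → v ≠ ψ z}
      ∈ 𝓝 (ψ x) := by
    refine Filter.inter_mem (mem_nhdsWithin_iff_eventually.1
      (extChartAt_target_mem_nhdsWithin x)) ?_
    by_cases h : z ∈ ψ.source
    · filter_upwards [isOpen_ne.mem_nhds (hxz h)] with v hv _ using hv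
    · exact Filter.Eventually.of_forall fun _ h' => (h h').elim
  obtain ⟨R, hR, hRU⟩ := Metric.nhds_basis_closedBall.mem_iff.1 hU
  -- Points within `r` of `ψ x` move by at most `r`, so they stay in the ball of radius `R`.
  set r := R / 2 with hr
  have hr0 : 0 < r := by positivity
  let χ : ContDiffBump (ψ x) := ⟨r / 2, r, by positivity, by linarith⟩
  let e₀ : EuclideanSpace ℝ (Fin d) := EuclideanSpace.single 0 1
  have he₀ : ‖e₀‖ = 1 := by simp [e₀]
  let f (t : unitInterval) (v : EuclideanSpace ℝ (Fin d)) : EuclideanSpace ℝ (Fin d) :=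
    v + ((t : ℝ) * r * χ v) • e₀
  have hf0 (t v) : f t v 0 = v 0 + (t : ℝ) * r * χ v := by simp [f, e₀]
  have hχ (v) (hv : χ v ≠ 0) : v ∈ Metric.ball (ψ x) r := by
    rw [← χ.support_eq]; exact hv
  have hnn (t : unitInterval) (v) : 0 ≤ (t : ℝ) * r * χ v :=
    mul_nonneg (mul_nonneg t.2.1 hr0.le) χ.nonneg
  have hv0 {v} (hv : v ∈ ψ.target) : 0 ≤ v 0 := by
    have := extChartAt_target_subset_range x hv
    rwa [range_modelWithCornersEuclideanHalfSpace] at this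
  have hft (t) : Set.MapsTo (f t) ψ.target ψ.target := by
    intro v hv
    by_cases h : χ v = 0
    · simpa [f, h] using hv
    · have hv' := hχ v h
      refine (hRU ?_).1 ?_
      · rw [Metric.mem_closedBall, dist_eq_norm]
        have h1 : ‖((t : ℝ) * r * χ v) • e₀‖ ≤ r := by
          rw [norm_smul, he₀, mul_one, Real.norm_of_nonneg (hnn t v)]
          have : (t : ℝ) * r * χ v ≤ 1 * r * 1 := by
            gcongr
            · exact χ.nonneg
            · exact t.2.2
            · exact χ.le_one
          linarith
        have h2 : ‖v - ψ x‖ < r := by rwa [← dist_eq_norm]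
        calc ‖f t v - ψ x‖ = ‖(v - ψ x) + ((t : ℝ) * r * χ v) • e₀‖ := by
              simp only [f]; congr 1; abel
          _ ≤ r + r := (norm_add_le _ _).trans (add_le_add h2.le h1)
          _ = R := by rw [hr]; ring
      · rw [range_modelWithCornersEuclideanHalfSpace]
        change 0 ≤ f t v 0
        rw [hf0]
        linarith [hnn t v, hv0 hv]
  have hint {t : unitInterval} {y} (hy : y ∈ ψ.source) (h : 0 < (t : ℝ) * r * χ (ψ y)) :
      chartExtend (𝓡∂ d) x (f t) y ∈ (𝓡∂ d).interior M := by
    rw [chartExtend_of_mem hy]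
    refine extChartAt_symm_mem_interior (hft t (ψ.map_source hy)) ?_
    rw [hf0]
    have := hv0 (ψ.map_source hy)
    linarith
  have hcont : Continuous fun q : unitInterval × M => chartExtend (𝓡∂ d) x (f q.1) q.2 := by
    -- The whole closed ball leaves the half-space; only its intersection with the range lies in the
    -- chart target.
    refine continuous_chartExtend (K := Metric.closedBall (ψ x) r ∩ Set.range (𝓡∂ d)) ?_
      ((isCompact_closedBall _ _).inter_right (𝓡∂ d).isClosed_range) ?_ ?_ hft
    · have := χ.continuous
      fun_prop
    · exact fun v hv => (hRU (Metric.closedBall_subset_closedBall (by linarith) hv.1)).1 hv.2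
    · intro t v hv hvK
      have : χ v = 0 := by
        by_contra h
        exact hvK ⟨Metric.ball_subset_closedBall (hχ v h), extChartAt_target_subset_range x hv⟩
      simp [f, this]
  have hid {t : unitInterval} {y} (h : y ∈ ψ.source → (t : ℝ) * r * χ (ψ y) = 0) :
      chartExtend (𝓡∂ d) x (f t) y = y :=
    chartExtend_of_eq fun hy => by simp only [f, ← hψ, h hy, zero_smul, add_zero]
  refine ⟨ψ.source ∩ ψ ⁻¹' Metric.ball (ψ x) r, ?_, ⟨_, hcont⟩, fun y => hid fun _ => by simp,
    fun t => hid fun hzs => ?_, fun t y => ?_, fun y hy => hint hy.1 ?_⟩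
  · exact (isOpen_extChartAt_preimage' x Metric.isOpen_ball).mem_nhds
      ⟨mem_extChartAt_source x, Metric.mem_ball_self hr0⟩
  · by_cases h : χ (ψ z) = 0
    · rw [h, mul_zero]
    · exact ((hRU (Metric.closedBall_subset_closedBall (by linarith)
        (Metric.ball_subset_closedBall (hχ _ h)))).2 hzs rfl).elim
  · by_cases h : y ∈ ψ.source → (t : ℝ) * r * χ (ψ y) = 0
    · exact .inl (hid h)
    · push Not at h
      exact .inr (hint h.1 (lt_of_le_of_ne (hnn _ _) h.2.symm))
  · have : 0 < χ (ψ y) := χ.pos_of_mem_ball hy.2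
    simp only [Set.Icc.coe_one]
    positivity

/-- Compact sets can be pushed into the interior. -/
theorem IsCompact.pushable [T2Space M] {z : M} (hz : z ∈ (𝓡∂ d).interior M) {K : Set M}
    (hK : IsCompact K) : Pushable d z K :=
  hK.induction_on
    ⟨⟨Prod.snd, continuous_snd⟩, fun _ => rfl, fun _ => rfl, fun _ _ => .inl rfl, fun _ h => h.elim⟩
    (fun _ _ hST ⟨H, h0, h1, h2, h3⟩ => ⟨H, h0, h1, h2, fun y hy => h3 y (hST hy)⟩)
    (fun _ _ => Pushable.union)
    (fun x _ => let ⟨S, hS, h⟩ := exists_pushable_nhds hz x; ⟨S, mem_nhdsWithin_of_mem_nhds hS, h⟩)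

/-- Every loop at an interior point is homotopic to a loop in the interior. -/
theorem exists_homotopic_interior [T2Space M] {z : M} (hz : z ∈ (𝓡∂ d).interior M) (γ : Path z z) :
    ∃ γ' : Path z z, γ.Homotopic γ' ∧ ∀ t, γ' t ∈ (𝓡∂ d).interior M := by
  obtain ⟨H, h0, hHz, -, hK⟩ := IsCompact.pushable hz (isCompact_range γ.continuous)
  refine ⟨⟨⟨fun t => H (1, γ t), by fun_prop⟩, by simp [hHz], by simp [hHz]⟩,
    ⟨⟨⟨⟨fun q => H (q.1, γ q.2), by fun_prop⟩, fun t => h0 _, fun t => rfl⟩, fun t x hx => ?_⟩⟩,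
    fun t => hK _ ⟨t, rfl⟩⟩
  rcases hx with rfl | rfl <;> simp [hHz]

/-- Loops in the interior that are homotopic in `M` are homotopic in the interior. -/
theorem exists_homotopy_interior [T2Space M] {z : M} (hz : z ∈ (𝓡∂ d).interior M) {γ γ' : Path z z}
    (h : γ.Homotopic γ') (hγ : ∀ t, γ t ∈ (𝓡∂ d).interior M)
    (hγ' : ∀ t, γ' t ∈ (𝓡∂ d).interior M) :
    ∃ F : γ.Homotopy γ', ∀ q, F q ∈ (𝓡∂ d).interior M := by
  obtain ⟨F⟩ := h
  obtain ⟨H, h0, hHz, hH, hK⟩ := IsCompact.pushable hz (isCompact_range F.continuous)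
  have hint (t) {y} (hy : y ∈ (𝓡∂ d).interior M) : H (t, y) ∈ (𝓡∂ d).interior M := by
    rcases hH t y with h | h
    · rwa [h]
    · exact h
  -- Pushing the homotopy also moves its two end loops. The deformation itself joins each of them to
  -- its pushed copy (`A`), inside the interior, and `B` joins the copies.
  let push (α : Path z z) : Path z z :=
    ⟨⟨fun t => H (1, α t), by fun_prop⟩, by simp [hHz], by simp [hHz]⟩
  let A (α : Path z z) : α.Homotopy (push α) :=
    ⟨⟨⟨fun q => H (q.1, α q.2), by fun_prop⟩, fun t => h0 _, fun t => rfl⟩, fun t x hx => by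
      rcases hx with rfl | rfl <;> simp [hHz]⟩
  let B : (push γ).Homotopy (push γ') :=
    ⟨⟨⟨fun q => H (1, F q), by fun_prop⟩, fun t => by simp [push], fun t => by simp [push]⟩,
      fun t x hx => by rcases hx with rfl | rfl <;> simp [hHz, push]⟩
  have hA {α : Path z z} (hα : ∀ t, α t ∈ (𝓡∂ d).interior M) (q) :
      A α q ∈ (𝓡∂ d).interior M := hint _ (hα _)
  have hB (q) : B q ∈ (𝓡∂ d).interior M := hK _ ⟨q, rfl⟩
  refine ⟨((A γ).trans B).trans (A γ').symm, fun q => ?_⟩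
  rw [Path.Homotopy.trans_apply]
  split_ifs
  · rw [Path.Homotopy.trans_apply]
    split_ifs
    · exact hA hγ _
    · exact hB _
  · exact hA hγ' (_, _)

end InteriorPush

/-! ### Diffeomorphisms of a vector space supported in a ball -/

section VectorSpace

variable {E : Type} [NormedAddCommGroup E] [NormedSpace ℝ E]

/-- The identity plus a contraction is a homeomorphism, and its derivative `1 - (-Dg)` is invertible
by the Neumann series, so the inverse is smooth. -/
theorem exists_contDiff_inverse_id_add [CompleteSpace E] {g : E → E} (hg : ContDiff ℝ ∞ g)
    {C : NNReal} (hC : LipschitzWith C g) (hC1 : C < 1) :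
    ∃ h : E → E, ContDiff ℝ ∞ h ∧ Function.LeftInverse h (fun v => v + g v) ∧
      Function.RightInverse h (fun v => v + g v) := by
  have hf : ApproximatesLinearOn (fun v => v + g v) (ContinuousLinearEquiv.refl ℝ E : E →L[ℝ] E)
      Set.univ C := by
    intro x _ y _
    have : x + g x - (y + g y) - (ContinuousLinearEquiv.refl ℝ E : E →L[ℝ] E) (x - y)
        = g x - g y := by
      simp only [ContinuousLinearEquiv.coe_refl, ContinuousLinearMap.coe_id', id]
      abel
    rw [this]
    exact hC.norm_sub_le x y
  have hc : Subsingleton E ∨ C <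
      ‖((ContinuousLinearEquiv.refl ℝ E).symm : E →L[ℝ] E)‖₊⁻¹ := by
    rcases subsingleton_or_nontrivial E with h | h
    · exact .inl h
    · right
      have : ‖((ContinuousLinearEquiv.refl ℝ E).symm : E →L[ℝ] E)‖₊ = 1 :=
        NNReal.eq ContinuousLinearMap.norm_id
      rwa [this, inv_one]
  let Θ := ApproximatesLinearOn.toHomeomorph _ hf hc
  have hΘ : ∀ v, Θ v = v + g v := fun _ => rfl
  have hlt (v : E) : ‖-fderiv ℝ g v‖ < 1 := by
    rw [norm_neg]
    exact (norm_fderiv_le_of_lipschitz ℝ hC).trans_lt (by exact_mod_cast hC1)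
  refine ⟨Θ.symm, Θ.contDiff_symm (f₀' := fun v => ContinuousLinearEquiv.ofUnit
    (Units.oneSub _ (hlt v))) (fun v => ?_) ?_, Θ.symm_apply_apply, Θ.apply_symm_apply⟩
  · have h : HasFDerivAt (fun v => v + g v) (ContinuousLinearMap.id ℝ E + fderiv ℝ g v) v :=
      (hasFDerivAt_id v).add ((hg.differentiable (by simp)).differentiableAt.hasFDerivAt)
    convert! h using 1
    ext u
    change ((1 : E →L[ℝ] E) - -fderiv ℝ g v) u = _
    simp
  · exact contDiff_id.add hg

/-- A smooth family of diffeomorphisms `f w` of `E` with support in a ball around `p`, such that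
`f w` is the translation by `w` near `p` if `w` is small. -/
theorem exists_translation_family [FiniteDimensional ℝ E] (p : E) {R : ℝ} (hR : 0 < R) :
    ∃ δ > 0, ∃ f : E → E → E, ContDiff ℝ ∞ (fun q : E × E => f q.1 q.2) ∧
      (∀ w, ∀ v ∉ Metric.closedBall p R, f w v = v) ∧ (∀ v, f 0 v = v) ∧
      (∀ w v, ‖w‖ < δ → dist v p < δ → f w v = v + w) ∧
      ∀ w, ∃ h : E → E, ContDiff ℝ ∞ h ∧ Function.LeftInverse h (f w) ∧
        Function.RightInverse h (f w) := by
  let χ : ContDiffBump p := ⟨R / 2, R, by positivity, by linarith⟩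
  obtain ⟨C, hC⟩ := (χ.contDiff (n := ⊤)).lipschitzWith_of_hasCompactSupport χ.hasCompactSupport
    (by simp)
  -- Chosen so that `C * ε < 1`. The cutoff `β` keeps `‖β w • w‖ ≤ ε` for every `w`, so each `f w`
  -- is a contraction away from the identity, with no restriction on `w`.
  set ε : ℝ := 1 / (C + 1) / 2 with hε
  have hε0 : 0 < ε := by positivity
  let β : ContDiffBump (0 : E) := ⟨ε / 2, ε, by positivity, by linarith⟩
  have hβ (w : E) : ‖β w • w‖ ≤ ε := by
    by_cases h : β w = 0
    · rw [h, zero_smul, norm_zero]; exact hε0.le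
    · have : w ∈ Metric.ball 0 ε := by rw [← β.support_eq]; exact h
      rw [norm_smul, Real.norm_of_nonneg β.nonneg]
      calc β w * ‖w‖ ≤ 1 * ε := by
            gcongr
            · exact β.le_one
            · exact (mem_ball_zero_iff.1 this).le
        _ = ε := one_mul _
  refine ⟨min (ε / 2) (R / 2), by positivity, fun w v => v + χ v • β w • w, ?_, fun w v hv => ?_,
    fun v => by simp, fun w v hw hv => ?_, fun w => ?_⟩
  · exact contDiff_snd.add ((χ.contDiff.comp contDiff_snd).smul
      ((β.contDiff.comp contDiff_fst).smul contDiff_fst))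
  · have : χ v = 0 := χ.zero_of_le_dist (not_le.1 hv).le
    simp [this]
  · have h1 : χ v = 1 := χ.one_of_mem_closedBall (hv.le.trans (min_le_right _ _))
    have h2 : β w = 1 := β.one_of_mem_closedBall
      (mem_closedBall_zero_iff.2 (hw.le.trans (min_le_left _ _)))
    simp [h1, h2]
  · refine exists_contDiff_inverse_id_add (g := fun v => χ v • β w • w)
      (C := C * ⟨ε, hε0.le⟩) (χ.contDiff.smul contDiff_const) ?_ ?_
    · refine LipschitzWith.of_dist_le_mul fun x y => ?_
      rw [dist_eq_norm, ← sub_smul, norm_smul]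
      have h1 : ‖χ x - χ y‖ ≤ C * dist x y := by
        rw [← dist_eq_norm]; exact hC.dist_le_mul x y
      calc ‖χ x - χ y‖ * ‖β w • w‖ ≤ (C * dist x y) * ε := by gcongr; exact hβ w
        _ = _ := by change _ = C * ε * dist x y; ring
    · rw [← NNReal.coe_lt_coe]
      change (C : ℝ) * ε < 1
      rw [hε]
      have : (0 : ℝ) ≤ C := C.2
      rw [div_div, ← mul_div_assoc, mul_one, div_lt_one (by positivity)]
      linarith

end VectorSpace

/-! ### Smooth families of self-maps -/

section Families

variable {E : Type} [NormedAddCommGroup E] [NormedSpace ℝ E] {H : Type} [TopologicalSpace H]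
  {I : ModelWithCorners ℝ E H} {M : Type u} [TopologicalSpace M] [ChartedSpace H M]
  {P : Type} [NormedAddCommGroup P] [NormedSpace ℝ P]

theorem contMDiff_chartExtend [IsManifold I ∞ M] [T2Space M] {x : M} {f : P → E → E} {K : Set E}
    (hfc : ContDiff ℝ ∞ fun q : P × E => f q.1 q.2) (hK : IsCompact K)
    (hKt : K ⊆ (extChartAt I x).target)
    (hf : ∀ p, ∀ v ∈ (extChartAt I x).target, v ∉ K → f p v = v)
    (hft : ∀ p, Set.MapsTo (f p) (extChartAt I x).target (extChartAt I x).target) :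
    ContMDiff (𝓘(ℝ, P).prod I) I ∞ fun q : P × M => chartExtend I x (f q.1) q.2 := by
  rintro ⟨p, y⟩
  by_cases hy : y ∈ (extChartAt I x).source
  · have h : ContMDiffOn (𝓘(ℝ, P).prod I) I ∞
        (fun q : P × M => (extChartAt I x).symm (f q.1 (extChartAt I x q.2)))
        (Set.univ ×ˢ (extChartAt I x).source) := by
      refine (contMDiffOn_extChartAt_symm x).comp (g := (extChartAt I x).symm)
        (f := fun q : P × M => f q.1 (extChartAt I x q.2)) ?_
        fun q hq => hft _ ((extChartAt I x).map_source hq.2)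
      refine hfc.contMDiff.comp_contMDiffOn (f := fun q : P × M => (q.1, extChartAt I x q.2)) ?_
      refine contMDiffOn_fst.prodMk_space ((contMDiffOn_extChartAt (x := x)).comp contMDiffOn_snd
        fun q hq => ?_)
      rw [← extChartAt_source I x]
      exact hq.2
    have hn : Set.univ ×ˢ (extChartAt I x).source ∈ 𝓝 (p, y) :=
      (isOpen_univ.prod (isOpen_extChartAt_source x)).mem_nhds ⟨trivial, hy⟩
    refine (h.contMDiffAt hn).congr_of_eventuallyEq ?_
    filter_upwards [hn] with q hq
    exact chartExtend_of_mem hq.2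
  · have hn : (Prod.snd ⁻¹' ((extChartAt I x).symm '' K)ᶜ : Set (P × M)) ∈ 𝓝 (p, y) := by
      refine ((isCompact_extChartAt_symm_image hK hKt).isClosed.isOpen_compl.preimage
        continuous_snd).mem_nhds ?_
      rintro ⟨v, hv, hvy⟩
      have := (extChartAt I x).map_target (hKt hv)
      rw [hvy] at this
      exact hy this
    refine contMDiffAt_snd.congr_of_eventuallyEq ?_
    filter_upwards [hn] with q hq
    exact chartExtend_of_notMem (hf _) hq

/-- The tangent map of `F w` is the tangent map of the whole family, restricted to vectors with zero
component in the parameter direction. -/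
theorem contMDiff_tangentMap_family {E₁ : Type} [NormedAddCommGroup E₁] [NormedSpace ℝ E₁]
    {H₁ : Type} [TopologicalSpace H₁] {J : ModelWithCorners ℝ E₁ H₁} {X : Type u}
    [TopologicalSpace X] [ChartedSpace H₁ X] [IsManifold J ∞ X] {F : P → X → X}
    (hF : ContMDiff (𝓘(ℝ, P).prod J) J ∞ fun q : P × X => F q.1 q.2) :
    ContMDiff (𝓘(ℝ, P).prod J.tangent) J.tangent ∞
      fun q : P × TangentBundle J X => tangentMap J J (F q.1) q.2 := by
  have : IsManifold J 1 X := .of_le (n := ∞) (by simp)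
  have h1 : ContMDiff (𝓘(ℝ, P).prod J.tangent) (𝓘(ℝ, P).prod J).tangent ∞
      fun q : P × TangentBundle J X => (equivTangentBundleProd 𝓘(ℝ, P) P J X).symm
        ((⟨q.1, 0⟩ : TangentBundle 𝓘(ℝ, P) P), q.2) :=
    contMDiff_equivTangentBundleProd_symm.comp
      (((Bundle.contMDiff_zeroSection ℝ (TangentSpace 𝓘(ℝ, P) : P → Type)).comp
        contMDiff_fst).prodMk contMDiff_snd)
  refine ((hF.contMDiff_tangentMap (m := ∞) le_rfl).comp h1).congr fun q => ?_
  obtain ⟨w, y, v⟩ := q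
  refine Bundle.TotalSpace.ext rfl (heq_of_eq ?_)
  change mfderiv J J (F w) y v =
    mfderiv (𝓘(ℝ, P).prod J) J (fun q : P × X => F q.1 q.2) (w, y) (0, v)
  have h2 : mfderiv J J (F w) y = _ := mfderiv_comp (g := fun q : P × X => F q.1 q.2)
    (f := fun y => (w, y)) (I' := 𝓘(ℝ, P).prod J) y (hF.mdifferentiable (by simp) _)
    (mdifferentiableAt_const.prodMk mdifferentiableAt_id)
  rw [h2, mfderiv_prod_right]
  rfl

variable [IsManifold I ∞ M]

theorem contMDiff_iterTangentMap_family {F : P → M → M}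
    (hF : ContMDiff (𝓘(ℝ, P).prod I) I ∞ fun q : P × M => F q.1 q.2) (k : ℕ) :
    ContMDiff (𝓘(ℝ, P).prod (iterTangent I M k).I) (iterTangent I M k).I ∞
      fun q : P × (iterTangent I M k).X => iterTangentMap I (F q.1) k q.2 := by
  induction k with
  | zero => exact hF
  | succ k ih =>
    exact contMDiff_tangentMap_family (J := (iterTangent I M k).I) (X := (iterTangent I M k).X)
      (F := fun w => iterTangentMap I (F w) k) ih

theorem continuous_proj_iterTangent (k : ℕ) : Continuous (iterTangent I M k).proj := by
  induction k with
  | zero => exact continuous_id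
  | succ k ih =>
    exact ih.comp (FiberBundle.continuous_proj (iterTangent I M k).E
      (TangentSpace (iterTangent I M k).I : (iterTangent I M k).X → Type))

theorem iterTangentMap_of_eq_id {f : M → M} {O : Set M} (hO : IsOpen O) (hf : ∀ y ∈ O, f y = y)
    (k : ℕ) {v : (iterTangent I M k).X} (hv : (iterTangent I M k).proj v ∈ O) :
    iterTangentMap I f k v = v := by
  induction k with
  | zero => exact hf v hv
  | succ k ih =>
    have h : iterTangentMap I f k =ᶠ[𝓝 v.proj] id := by
      filter_upwards [(hO.preimage (continuous_proj_iterTangent k)).mem_nhds hv] with y hy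
      exact ih hy
    change tangentMap _ _ (iterTangentMap I f k) v = v
    refine Eq.trans ?_ (congrFun (tangentMap_id (I := (iterTangent I M k).I)) v)
    simp only [tangentMap, h.mfderiv_eq]
    exact Bundle.TotalSpace.ext h.eq_of_nhds HEq.rfl

/-- Composition with a smooth family of diffeomorphisms with common compact support is continuous
in the Whitney topology. -/
theorem continuous_family_mul [T2Space M] {C : Set M} (hC : IsCompact C) (D : P → M ≃ₘ⟮I, I⟯ M)
    (hD : ContMDiff (𝓘(ℝ, P).prod I) I ∞ fun q : P × M => D q.1 q.2)
    (hDC : ∀ w, ∀ y ∉ C, D w y = y) :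
    Continuous fun q : P × (M ≃ₘ⟮I, I⟯ M) => D q.1 * q.2 := by
  refine continuous_generateFrom_iff.2 ?_
  rintro _ ⟨k, L, W, hL, hfin, hW, rfl⟩
  set T : P → (iterTangent I M k).X → (iterTangent I M k).X := fun w => iterTangentMap I (D w) k
    with hT
  have hTc : Continuous fun q : P × (iterTangent I M k).X => T q.1 q.2 :=
    (contMDiff_iterTangentMap_family (F := fun w => D w) hD k).continuous
  have hTC (w v) (hv : (iterTangent I M k).proj v ∉ C) : T w v = v :=
    iterTangentMap_of_eq_id hC.isClosed.isOpen_compl (hDC w) k hv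
  have hcomp (w : P) (φ : M ≃ₘ⟮I, I⟯ M) (v) : iterTangentMap I (D w * φ : M ≃ₘ⟮I, I⟯ M) k v
      = T w (iterTangentMap I φ k v) :=
    congrFun (iterTangentMap_comp I (D w).contMDiff φ.contMDiff k) v
  rw [isOpen_iff_mem_nhds]
  rintro ⟨w, φ⟩ hwφ
  have hwφ' (i : ℕ) (v) (hv : v ∈ L i) : T w (iterTangentMap I φ k v) ∈ W i := by
    rw [← hcomp]; exact hwφ i hv
  -- Only finitely many `L i` are carried by `φ` to meet the compact support, by local finiteness.
  -- The tube lemma restricts `w` for these.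
  set S : Set ℕ := {i | ((iterTangent I M k).proj '' L i ∩ φ ⁻¹' C).Nonempty} with hS
  have hSfin : S.Finite := by
    refine hfin.finite_nonempty_inter_compact ?_
    rw [show φ ⁻¹' C = φ.symm '' C from (φ.toEquiv.symm.image_eq_preimage_symm C).symm]
    exact hC.image φ.symm.continuous
  have hTφ : Continuous (iterTangentMap I φ k) :=
    (contMDiff_iterTangentMap I φ.contMDiff k).continuous
  have tube (i : ℕ) : ∃ u : Set P, ∃ V : Set (iterTangent I M k).X, IsOpen u ∧ IsOpen V ∧ w ∈ u ∧
      iterTangentMap I φ k '' L i ⊆ V ∧ ∀ w' ∈ u, ∀ v ∈ V, T w' v ∈ W i := by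
    obtain ⟨u, V, hu, hV, hwu, hLV, huV⟩ := generalized_tube_lemma
      (n := {q : P × (iterTangent I M k).X | T q.1 q.2 ∈ W i}) (isCompact_singleton (x := w))
      ((hL i).image hTφ) ((hW i).preimage hTc) (by
        rintro ⟨a, b⟩ ⟨ha, v, hv, rfl⟩
        cases ha
        exact hwφ' i v hv)
    exact ⟨u, V, hu, hV, hwu rfl, hLV, fun w' hw' v hv => huV (Set.mk_mem_prod hw' hv)⟩
  choose u V hu hV hwu hLV huV using tube
  classical
  -- For the other indices, staying off `C` makes every `T w'` act as the identity, so they impose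
  -- no condition on `w'`.
  let W' (i : ℕ) : Set (iterTangent I M k).X :=
    if i ∈ S then V i else W i ∩ (iterTangent I M k).proj ⁻¹' Cᶜ
  have hW'o (i) : IsOpen (W' i) := by
    by_cases hi : i ∈ S
    · simpa only [W', if_pos hi] using hV i
    · simp only [W', if_neg hi]
      exact (hW i).inter (hC.isClosed.isOpen_compl.preimage (continuous_proj_iterTangent k))
  have hφ : φ ∈ whitneySet I k L W' := by
    intro i v hv
    by_cases hi : i ∈ S
    · simp only [W', if_pos hi]
      exact hLV i ⟨v, hv, rfl⟩
    · have hnot : (iterTangent I M k).proj (iterTangentMap I φ k v) ∉ C := by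
        rw [proj_iterTangentMap]
        exact fun h => hi ⟨_, ⟨v, hv, rfl⟩, h⟩
      simp only [W', if_neg hi]
      refine ⟨?_, hnot⟩
      rw [← hTC w _ hnot]
      exact hwφ' i v hv
  have hN : (⋂ i ∈ S, u i) ×ˢ whitneySet I k L W' ∈ 𝓝 (w, φ) := by
    refine prod_mem_nhds ((Filter.biInter_mem hSfin).2 fun i _ => (hu i).mem_nhds (hwu i)) ?_
    have ho : IsOpen (whitneySet I k L W') :=
      TopologicalSpace.isOpen_generateFrom_of_mem ⟨k, L, W', hL, hfin, hW'o, rfl⟩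
    exact ho.mem_nhds hφ
  filter_upwards [hN]
  rintro ⟨w', φ'⟩ ⟨hw', hφ'⟩ i v hv
  rw [hcomp]
  have := hφ' i hv
  by_cases hi : i ∈ S
  · simp only [W', if_pos hi] at this
    exact huV i w' (Set.mem_iInter₂.1 hw' i hi) _ this
  · simp only [W', if_neg hi] at this
    rw [hTC _ _ this.2]
    exact this.1

end Families

/-! ### Local pushes by diffeomorphisms, homeomorphisms and homotopy automorphisms -/

section LocalPush

variable {E : Type} [NormedAddCommGroup E] [NormedSpace ℝ E] {H : Type} [TopologicalSpace H]
  {I : ModelWithCorners ℝ E H} {M : Type u} [TopologicalSpace M] [ChartedSpace H M]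

/-- If `f v ∉ K`, then `f (f v) = f v`, and injectivity gives `f v = v`. -/
theorem mapsTo_of_eq_id {α : Type*} {K T : Set α} {f : α → α} (hKT : K ⊆ T)
    (hf : ∀ v ∉ K, f v = v) (hinj : Function.Injective f) : Set.MapsTo f T T := fun v hv => by
  by_cases h : f v ∈ K
  · exact hKT h
  · rwa [hinj (hf _ h)]

/-- The diffeomorphism that is given by `f` in the chart at `x`, and by the identity outside. -/
def chartExtendDiffeomorph [IsManifold I ∞ M] [T2Space M] {x : M} {f g : E → E} {K : Set E}
    (hfc : ContDiff ℝ ∞ f) (hgc : ContDiff ℝ ∞ g) (hK : IsCompact K)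
    (hKt : K ⊆ (extChartAt I x).target) (hf : ∀ v ∉ K, f v = v)
    (hgf : Function.LeftInverse g f) (hfg : Function.RightInverse g f) : M ≃ₘ⟮I, I⟯ M :=
  have hg : ∀ v ∉ K, g v = v := fun v hv => by rw [← hf v hv, hgf, hf v hv]
  have hft := mapsTo_of_eq_id hKt hf hgf.injective
  have hgt := mapsTo_of_eq_id hKt hg hfg.injective
  have smooth {f : E → E} (hfc : ContDiff ℝ ∞ f) (hf : ∀ v ∉ K, f v = v)
      (hft : Set.MapsTo f (extChartAt I x).target (extChartAt I x).target) :
      ContMDiff I I ∞ (chartExtend I x f) :=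
    (contMDiff_chartExtend (P := ℝ) (f := fun _ => f) (hfc.comp contDiff_snd) hK hKt
      (fun _ v _ => hf v) fun _ => hft).comp (contMDiff_const.prodMk contMDiff_id : ContMDiff I
        (𝓘(ℝ, ℝ).prod I) ∞ fun y : M => ((0 : ℝ), y))
  { toFun := chartExtend I x f
    invFun := chartExtend I x g
    left_inv := fun y => by
      rw [chartExtend_comp hft, hgf.comp_eq_id]
      exact chartExtend_of_eq fun _ => rfl
    right_inv := fun y => by
      rw [chartExtend_comp hgt, hfg.comp_eq_id]
      exact chartExtend_of_eq fun _ => rfl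
    contMDiff_toFun := smooth hfc hf hft
    contMDiff_invFun := smooth hgc hg hgt }

/-- Near an interior point `x` there is a continuous family `D` of diffeomorphisms that fix the
boundary, such that `D w` translates by `w` in the chart at `x`. -/
theorem exists_push_family [IsManifold I ∞ M] [T2Space M] [FiniteDimensional ℝ E] {x : M}
    (hx : x ∈ I.interior M) :
    ∃ U ∈ 𝓝 x, ∃ D : E → M ≃ₘ⟮I, I⟯ M, D 0 = 1 ∧ (∀ w, ∀ y ∈ I.boundary M, D w y = y) ∧
      ContinuousOn (extChartAt I x) U ∧
      (∀ y ∈ U, ∀ y' ∈ U, D (extChartAt I x y' - extChartAt I x y) y = y') ∧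
      (Continuous fun q : E × M => D q.1 q.2) ∧
      Continuous fun q : E × (M ≃ₘ⟮I, I⟯ M) => D q.1 * q.2 := by
  set ψ := extChartAt I x with hψ
  -- The support is placed in the interior of `M`, so that the boundary is fixed.
  have hnhds : ψ.target ∩ ψ.symm ⁻¹' I.interior M ∈ 𝓝 (ψ x) := by
    have ht : ψ.target ∈ 𝓝 (ψ x) := by
      have := extChartAt_target_mem_nhdsWithin (I := I) x
      rwa [nhdsWithin_eq_nhds.2 (range_mem_nhds_isInteriorPoint hx)] at this
    refine Filter.inter_mem ht ?_
    have hc : ContinuousAt ψ.symm (ψ x) :=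
      (continuousOn_extChartAt_symm x).continuousAt ht
    refine hc.preimage_mem_nhds ?_
    rw [extChartAt_to_inv]
    exact (I.isOpen_interior (n := ∞) (by simp)).mem_nhds hx
  obtain ⟨R, hR, hRt⟩ := Metric.nhds_basis_closedBall.mem_iff.1 hnhds
  have hKt : Metric.closedBall (ψ x) R ⊆ ψ.target := fun v hv => (hRt hv).1
  have hK := isCompact_closedBall (ψ x) R
  obtain ⟨δ, hδ, f, hfc, hfK, hf0, hfδ, hfinv⟩ := exists_translation_family (ψ x) hR
  choose g hgc hgf hfg using hfinv
  have hfw (w) : ContDiff ℝ ∞ (f w) := hfc.comp (contDiff_const.prodMk contDiff_id)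
  let D (w : E) : M ≃ₘ⟮I, I⟯ M :=
    chartExtendDiffeomorph (hfw w) (hgc w) hK hKt (hfK w) (hgf w) (hfg w)
  have hDf (w y) : D w y = chartExtend I x (f w) y := rfl
  have hft (w) : Set.MapsTo (f w) ψ.target ψ.target :=
    mapsTo_of_eq_id hKt (hfK w) (hgf w).injective
  have hDs : ContMDiff (𝓘(ℝ, E).prod I) I ∞ fun q : E × M => D q.1 q.2 :=
    contMDiff_chartExtend hfc hK hKt (fun w v _ => hfK w v) hft
  have hDC (w) (y) (hy : y ∉ ψ.symm '' Metric.closedBall (ψ x) R) : D w y = y :=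
    chartExtend_of_notMem (fun v _ => hfK w v) hy
  refine ⟨ψ.source ∩ ψ ⁻¹' Metric.ball (ψ x) (δ / 2), ?_, D, ?_, fun w y hy => ?_,
    (continuousOn_extChartAt x).mono Set.inter_subset_left, fun y hy y' hy' => ?_, hDs.continuous,
    continuous_family_mul (isCompact_extChartAt_symm_image hK hKt) D hDs hDC⟩
  · exact (isOpen_extChartAt_preimage' x Metric.isOpen_ball).mem_nhds
      ⟨mem_extChartAt_source x, Metric.mem_ball_self (by positivity)⟩
  · ext y
    exact chartExtend_of_eq fun _ => hf0 _
  · refine hDC w y ?_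
    rintro ⟨v, hv, rfl⟩
    exact (I.disjoint_interior_boundary (M := M)).le_bot ⟨(hRt hv).2, hy⟩
  · have h1 : dist (ψ y) (ψ x) < δ / 2 := hy.2
    have h2 : dist (ψ y') (ψ x) < δ / 2 := hy'.2
    have h3 : ‖ψ y' - ψ y‖ < δ := by
      rw [← dist_eq_norm]
      linarith [dist_triangle_right (ψ y') (ψ y) (ψ x)]
    rw [hDf, chartExtend_of_mem hy.1, ← hψ, hfδ _ _ h3 (by linarith), add_sub_cancel,
      ψ.left_inv hy'.1]

/-- The pushing diffeomorphisms are transported along `j`. Of the two continuity properties offered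
to `hjc`, the Whitney topology uses the second and the compact-open topologies the first. -/
theorem hasLocalPush_of_hom [IsManifold I ∞ M] [T2Space M] [FiniteDimensional ℝ E]
    {G : Type u} [Monoid G] [TopologicalSpace G] [SeparatelyContinuousMul G] [MulAction G M]
    (j : (M ≃ₘ⟮I, I⟯ M) →* G) (hj : ∀ φ (y : M), j φ • y = φ y)
    (hjc : ∀ D : E → M ≃ₘ⟮I, I⟯ M, (Continuous fun q : E × M => D q.1 q.2) →
      (Continuous fun q : E × (M ≃ₘ⟮I, I⟯ M) => D q.1 * q.2) →
      Continuous fun q : E × G => j (D q.1) * q.2)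
    {A : Set M} (hA : A ⊆ I.boundary M) : HasLocalPush (AutFixing G A) (I.interior M) := by
  intro x hx
  obtain ⟨U, hU, D, hD0, hDb, hψ, hDψ, hDc, hDm⟩ := exists_push_family hx
  have hmem (w) : j (D w) ∈ fixingSubmonoid G A :=
    (mem_fixingSubmonoid_iff G).2 fun y hy => by rw [hj, hDb w y (hA hy)]
  refine ⟨U, hU, fun y y' => ⟨_, hmem (extChartAt I x y' - extChartAt I x y)⟩, fun y _ => ?_,
    fun y hy y' hy' => ?_, ?_⟩
  · exact Subtype.ext (by simp [hD0])
  · exact (hj _ y).trans (hDψ y hy y' hy')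
  · rw [Topology.IsInducing.subtypeVal.continuousOn_iff]
    refine (hjc D hDc hDm).comp_continuousOn (f := fun q : (M × M) × AutFixing G A =>
      (extChartAt I x q.1.2 - extChartAt I x q.1.1, (q.2 : G))) ?_
    refine ContinuousOn.prodMk (ContinuousOn.sub ?_ ?_) (by fun_prop)
    · exact hψ.comp (by fun_prop) fun q hq => hq.1.2
    · exact hψ.comp (by fun_prop) fun q hq => hq.1.1

/-- Diffeomorphisms as homeomorphisms. -/
def diffToHomeo [IsManifold I ∞ M] : (M ≃ₘ⟮I, I⟯ M) →* (M ≃ₜ M) where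
  toFun φ := φ.toHomeomorph
  map_one' := rfl
  map_mul' _ _ := rfl

/-- Diffeomorphisms as homotopy automorphisms. -/
def diffToHAut [IsManifold I ∞ M] : (M ≃ₘ⟮I, I⟯ M) →* HAut M where
  toFun φ := ⟨⟨φ, φ.continuous⟩, ⟨φ.symm, φ.symm.continuous⟩, by
    constructor <;> convert! ContinuousMap.Homotopic.refl _ using 1 <;> ext <;> simp⟩
  map_one' := rfl
  map_mul' _ _ := rfl

/-- By the exponential law it suffices to check the uncurried map; local compactness makes
evaluation jointly continuous. -/
theorem continuous_comp_family [LocallyCompactSpace M] {P Q : Type*} [TopologicalSpace P]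
    [TopologicalSpace Q] {D : P → C(M, M)} (hD : Continuous fun q : P × M => D q.1 q.2)
    {Φ : Q → C(M, M)} (hΦ : Continuous Φ) :
    Continuous fun q : P × Q => (D q.1).comp (Φ q.2) :=
  ContinuousMap.continuous_of_continuous_uncurry _ <|
    hD.comp (g := fun q : P × M => D q.1 q.2)
      (f := fun q : (P × Q) × M => (q.1.1, Φ q.1.2 q.2)) (by fun_prop)

variable [IsManifold I ∞ M] [T2Space M] [FiniteDimensional ℝ E] {A : Set M}

theorem hasLocalPush_diff (hA : A ⊆ I.boundary M) :
    HasLocalPush (AutFixing (M ≃ₘ⟮I, I⟯ M) A) (I.interior M) :=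
  hasLocalPush_of_hom (.id _) (fun _ _ => rfl) (fun _ _ h => h) hA

theorem hasLocalPush_homeo (hA : A ⊆ I.boundary M) :
    HasLocalPush (AutFixing (M ≃ₜ M) A) (I.interior M) := by
  have := Manifold.locallyCompact_of_finiteDimensional (M := M) I
  refine hasLocalPush_of_hom diffToHomeo (fun _ _ => rfl) (fun D hD _ => ?_) hA
  exact continuous_induced_rng.2
    (continuous_comp_family (D := fun w => ⟨D w, (D w).continuous⟩)
      (Φ := fun φ : M ≃ₜ M => ⟨φ, φ.continuous⟩) hD continuous_induced_dom)

theorem hasLocalPush_hAut (hA : A ⊆ I.boundary M) :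
    HasLocalPush (AutFixing (HAut M) A) (I.interior M) := by
  have := Manifold.locallyCompact_of_finiteDimensional (M := M) I
  refine hasLocalPush_of_hom diffToHAut (fun _ _ => rfl) (fun D hD _ => ?_) hA
  exact Continuous.subtype_mk
    (continuous_comp_family (D := fun w => ⟨D w, (D w).continuous⟩) hD continuous_subtype_val) _

end LocalPush

/-! ### Joint continuity of the actions -/

section Actions

theorem continuousSMul_of_continuous {M G : Type*} [TopologicalSpace M] [LocallyCompactSpace M]
    [TopologicalSpace G] [SMul G M] {j : G → C(M, M)} (hj : Continuous j)
    (h : ∀ g (y : M), j g y = g • y) : ContinuousSMul G M where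
  continuous_smul := by
    simp only [← h]
    fun_prop

theorem continuousSMul_homeo {M : Type u} [TopologicalSpace M] [LocallyCompactSpace M] :
    ContinuousSMul (M ≃ₜ M) M :=
  continuousSMul_of_continuous continuous_induced_dom fun _ _ => rfl

theorem continuousSMul_hAut {M : Type u} [TopologicalSpace M] [LocallyCompactSpace M] :
    ContinuousSMul (HAut M) M :=
  continuousSMul_of_continuous (j := fun f => f.1) continuous_subtype_val fun _ _ => rfl

theorem continuousSMul_diff {E : Type} [NormedAddCommGroup E] [NormedSpace ℝ E] {H : Type}
    [TopologicalSpace H] {I : ModelWithCorners ℝ E H} {M : Type u} [TopologicalSpace M]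
    [ChartedSpace H M] [IsManifold I ∞ M] [LocallyCompactSpace M] :
    ContinuousSMul (M ≃ₘ⟮I, I⟯ M) M := by
  refine continuousSMul_of_continuous (j := fun φ => ⟨φ, φ.continuous⟩) ?_ fun _ _ => rfl
  refine ContinuousMap.continuous_compactOpen.2 fun K hK U hU => ?_
  -- A compact-open condition is a Whitney condition of order 0 whose only possibly nonempty member
  -- is `L 0 = K`.
  refine TopologicalSpace.isOpen_generateFrom_of_mem
    ⟨0, fun i => {y | i = 0 ∧ y ∈ K}, fun _ => U, fun i => ?_, fun x => ⟨Set.univ, Filter.univ_mem,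
      (Set.finite_singleton 0).subset ?_⟩, fun _ => hU, ?_⟩
  · by_cases hi : i = 0
    · simp only [hi, true_and]
      exact hK
    · simp [hi]
  · rintro i ⟨_, ⟨y, hy, -⟩, -⟩
    exact hy.1
  · ext φ
    exact ⟨fun h i y hy => h hy.2, fun h y hy => h 0 ⟨rfl, hy⟩⟩

end Actions

/-! ### The point-pushing homomorphism -/

section PointPushingMap

theorem mem_fixingSubmonoid_union_singleton {M G : Type*} [Monoid G] [MulAction G M] {A : Set M}
    {z : M} {g : G} :
    g ∈ fixingSubmonoid G (A ∪ {z}) ↔ g ∈ fixingSubmonoid G A ∧ g • z = z := by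
  simp [mem_fixingSubmonoid_iff, or_imp, forall_and, and_comm]

variable {d : ℕ} [NeZero d] {M : Type u} [TopologicalSpace M]
  [ChartedSpace (EuclideanHalfSpace d) M]
  {G : Type u} [Monoid G] [TopologicalSpace G] [MulAction G M] {A : Set M} {z : M}

/-- Lifting a homotopy from `γ` to `γ'` replaces `Φ` by a lift of `γ'` with the same ends. Its
reverse followed by `Φ'` runs from `ψ` to `ψ'` over a null-homotopic loop; lifting the contraction
yields a path that fixes `z`. -/
theorem isPush_unique [IsManifold (𝓡∂ d) ∞ M] [T2Space M] (hz : z ∈ (𝓡∂ d).interior M)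
    (hG : HasLocalPush (AutFixing G A) ((𝓡∂ d).interior M)) {a : FundamentalGroup M z}
    {c c' : ZerothHomotopy (AutFixing G (A ∪ {z}))} (h : IsPush (𝓡∂ d) G A z a c)
    (h' : IsPush (𝓡∂ d) G A z a c') : c = c' := by
  obtain ⟨γ, Φ, ψ, hγ, ha, hΦ0, hΦ, hψ, rfl⟩ := h
  obtain ⟨γ', Φ', ψ', hγ', ha', hΦ0', hΦ', hψ', rfl⟩ := h'
  obtain ⟨F, hF⟩ := exists_homotopy_interior hz (Path.Homotopic.Quotient.exact (ha.trans ha'.symm))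
    hγ hγ'
  obtain ⟨Θ, hΘ, hΘe⟩ := hG.exists_lift F.toContinuousMap hF Φ fun t => (hΦ t).trans (by simp)
  have hΘ0 : Θ 0 = 1 := (hΘe 0 fun r => by simp).trans hΦ0
  have hΘ1 : Θ 1 = Φ 1 := hΘe 1 fun r => by simp
  let p : Path (1 : AutFixing G A) (Φ 1) := ⟨Θ, hΘ0, hΘ1⟩
  let p' : Path (1 : AutFixing G A) (Φ' 1) := ⟨Φ', hΦ0', rfl⟩
  let δ := γ'.symm.trans γ'
  have hp (t) : p t • z = γ' t := (hΘ t).trans (F.apply_one t)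
  have hδ (t) : (p.symm.trans p') t • z = δ t := by
    simp only [δ, Path.trans_apply]
    split_ifs
    · exact hp _
    · exact hΦ' _
  have hδint (t) : δ t ∈ (𝓡∂ d).interior M := by
    simp only [δ, Path.trans_apply]
    split_ifs <;> exact hγ' _
  obtain ⟨F', hF'⟩ := exists_homotopy_interior hz
    (⟨(Path.Homotopy.reflSymmTrans γ').symm⟩ : δ.Homotopic (.refl z)) hδint fun _ => hz
  obtain ⟨Q, hQ, hQe⟩ := hG.exists_lift F'.toContinuousMap hF' (p.symm.trans p').toContinuousMap
    fun t => (hδ t).trans (by simp)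
  have hQ' (t) : (Q t : G) ∈ fixingSubmonoid G (A ∪ {z}) :=
    mem_fixingSubmonoid_union_singleton.2 ⟨(Q t).2, (hQ t).trans (by simp)⟩
  refine Quotient.sound ⟨⟨⟨fun t => ⟨Q t, hQ' t⟩, by fun_prop⟩, ?_, ?_⟩⟩
  · refine Subtype.ext ?_
    rw [← hψ]
    exact congrArg Subtype.val ((hQe 0 fun r => by simp).trans (p.symm.trans p').source)
  · refine Subtype.ext ?_
    rw [← hψ']
    exact congrArg Subtype.val ((hQe 1 fun r => by simp).trans (p.symm.trans p').target)

theorem exists_isPush [IsManifold (𝓡∂ d) ∞ M] [T2Space M] (hz : z ∈ (𝓡∂ d).interior M)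
    (hG : HasLocalPush (AutFixing G A) ((𝓡∂ d).interior M)) (a : FundamentalGroup M z) :
    ∃ c, IsPush (𝓡∂ d) G A z a c := by
  obtain ⟨γ₀, rfl⟩ := Path.Homotopic.Quotient.mk_surjective a
  obtain ⟨γ, hγ₀, hγ⟩ := exists_homotopic_interior hz γ₀
  -- The homotopy `γ (r t)` starts at the constant loop, which the constant path at the identity
  -- lifts.
  obtain ⟨Φ, hΦ, hΦe⟩ := hG.exists_lift (z := z) ⟨fun q => γ (q.1 * q.2), by fun_prop⟩
    (fun q => hγ _) (.const _ 1) fun t => by simp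
  have hΦ' (t) : Φ t • z = γ t := by simpa using hΦ t
  have hΦ1 : (Φ 1 : G) ∈ fixingSubmonoid G (A ∪ {z}) :=
    mem_fixingSubmonoid_union_singleton.2 ⟨(Φ 1).2, (hΦ' 1).trans (by simp)⟩
  exact ⟨_, γ, Φ, ⟨_, hΦ1⟩, hγ, Quotient.sound hγ₀.symm, hΦe 0 fun r => by simp, hΦ', rfl, rfl⟩

variable [SeparatelyContinuousMul G]

theorem isPush_one (hz : z ∈ (𝓡∂ d).interior M) : IsPush (𝓡∂ d) G A z 1 1 :=
  ⟨.refl z, .const _ 1, 1, fun _ => hz, rfl, rfl, fun _ => one_smul G z, rfl, rfl⟩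

theorem IsPush.mul {a b : FundamentalGroup M z} {c c' : ZerothHomotopy (AutFixing G (A ∪ {z}))}
    (h : IsPush (𝓡∂ d) G A z a c) (h' : IsPush (𝓡∂ d) G A z b c') :
    IsPush (𝓡∂ d) G A z (a * b) (c * c') := by
  obtain ⟨γ, Φ, ψ, hγ, rfl, hΦ0, hΦ, hψ, rfl⟩ := h
  obtain ⟨γ', Φ', ψ', hγ', rfl, hΦ0', hΦ', hψ', rfl⟩ := h'
  let p : Path (1 : AutFixing G A) (Φ 1) := ⟨Φ, hΦ0, rfl⟩
  let p' : Path (1 : AutFixing G A) (Φ' 1) := ⟨Φ', hΦ0', rfl⟩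
  -- The second half is `Φ t * Φ' 1`; it lifts `γ` because `Φ' 1` fixes `z`. The loop of `b` comes
  -- first, as in the product `a * b`.
  let q : Path (1 : AutFixing G A) (Φ 1 * Φ' 1) :=
    p'.trans ((p.map (continuous_mul_const (Φ' 1))).cast (one_mul _).symm rfl)
  refine ⟨γ'.trans γ, q.toContinuousMap, ψ * ψ', fun t => ?_, rfl, q.source, fun t => ?_, ?_, rfl⟩
  · rw [Path.trans_apply]
    split_ifs
    · exact hγ' _
    · exact hγ _
  · change q t • z = _
    simp only [q, Path.trans_apply]
    split_ifs
    · exact hΦ' _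
    · refine (mul_smul _ (Φ' 1) z).trans ?_
      have : Φ' 1 • z = z := (hΦ' 1).trans (by simp)
      rw [this]
      exact hΦ _
  · change ((q 1 : AutFixing G A) : G) = ψ * ψ'
    rw [q.target, ← hψ, ← hψ']
    rfl

theorem exists_isPointPushingMap [IsManifold (𝓡∂ d) ∞ M] [T2Space M] (hz : z ∈ (𝓡∂ d).interior M)
    (hG : HasLocalPush (AutFixing G A) ((𝓡∂ d).interior M)) :
    ∃ p : FundamentalGroup M z →* ZerothHomotopy (AutFixing G (A ∪ {z})),
      IsPointPushingMap (𝓡∂ d) G A z p := by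
  choose p hp using exists_isPush (G := G) (A := A) hz hG
  refine ⟨⟨⟨p, isPush_unique hz hG (hp 1) (isPush_one hz)⟩,
    fun a b => isPush_unique hz hG (hp _) ((hp a).mul (hp b))⟩, fun a c => ⟨?_, ?_⟩⟩
  · rintro rfl
    exact hp a
  · exact isPush_unique hz hG (hp a)

/-- If pushing along `a` is trivial, then `a` is the trace of `z` under a loop of self-maps of `M`
at the identity that fix `A`. -/
theorem IsPush.exists_homotopy [ContinuousSMul G M] {a : FundamentalGroup M z}
    (h : IsPush (𝓡∂ d) G A z a 1) :
    ∃ F : ContinuousMap.Homotopy (.id M) (.id M), (∀ t, ∀ y ∈ A, F (t, y) = y) ∧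
      FundamentalGroup.fromPath (Path.Homotopic.Quotient.mk (F.evalAt z)) = a := by
  obtain ⟨γ, Φ, ψ, -, rfl, hΦ0, hΦ, hψ, h1⟩ := h
  obtain ⟨q⟩ : Joined ψ 1 := Quotient.exact h1
  let p : Path (1 : G) ψ := ⟨⟨fun t => Φ t, by fun_prop⟩, congrArg Subtype.val hΦ0, hψ⟩
  -- Along `q` the point `z` stays fixed, so the trace of `z` under this loop is `γ` followed by a
  -- constant path.
  let r : Path (1 : G) 1 := p.trans (q.map continuous_subtype_val)
  have hq (t) := (mem_fixingSubmonoid_union_singleton (A := A)).1 (q t).2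
  have hrA (t) : ∀ y ∈ A, r t • y = y := by
    rw [← mem_fixingSubmonoid_iff G]
    simp only [r, Path.trans_apply]
    split_ifs
    · exact (Φ _).2
    · exact (hq _).1
  have hrz (t) : r t • z = γ.trans (.refl z) t := by
    simp only [r, Path.trans_apply]
    split_ifs
    · exact hΦ _
    · exact (hq _).2
  refine ⟨⟨⟨fun x => r x.1 • x.2, by fun_prop⟩, fun y => by simp, fun y => by simp⟩, hrA, ?_⟩
  refine Eq.trans (congrArg Path.Homotopic.Quotient.mk (?_ : _ = γ.trans (.refl z)))
    (Quotient.sound ⟨Path.Homotopy.transRefl γ⟩)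
  ext t
  exact hrz t

/-- This is the naturality square of `F` over `p`; both ends of `F` are the identity, so both
horizontal sides are `p` itself. -/
theorem trans_evalAt {M : Type*} [TopologicalSpace M]
    (F : ContinuousMap.Homotopy (.id M) (.id M)) {x y : M} (p : Path x y) :
    (p.trans (F.evalAt y)).Homotopic ((F.evalAt x).trans p) := by
  simpa using Path.Homotopic.map_trans_evalAt F p

theorem kernelCentral [IsManifold (𝓡∂ d) ∞ M] [T2Space M] [ContinuousSMul G M]
    (hz : z ∈ (𝓡∂ d).interior M) (hG : HasLocalPush (AutFixing G (∅ : Set M)) ((𝓡∂ d).interior M)) :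
    KernelCentral (𝓡∂ d) G z := by
  obtain ⟨p, hp⟩ := exists_isPointPushingMap hz hG
  refine ⟨p, hp, fun a ha => Subgroup.mem_center_iff.2 fun b => ?_⟩
  obtain ⟨F, -, rfl⟩ := ((hp a 1).1 ha).exists_homotopy
  obtain ⟨β, rfl⟩ := Path.Homotopic.Quotient.mk_surjective b
  exact Quotient.sound (trans_evalAt F β).symm

theorem boundaryInjective [IsManifold (𝓡∂ d) ∞ M] [T2Space M] [PathConnectedSpace M]
    [ContinuousSMul G M] (hz : z ∈ (𝓡∂ d).interior M) (hne : ((𝓡∂ d).boundary M).Nonempty)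
    (hG : HasLocalPush (AutFixing G ((𝓡∂ d).boundary M)) ((𝓡∂ d).interior M)) :
    BoundaryInjective (𝓡∂ d) G z := by
  obtain ⟨p, hp⟩ := exists_isPointPushingMap hz hG
  refine ⟨p, hp, (injective_iff_map_eq_one p).2 fun a ha => ?_⟩
  obtain ⟨F, hF, rfl⟩ := ((hp a 1).1 ha).exists_homotopy
  obtain ⟨y, hy⟩ := hne
  obtain ⟨α⟩ := PathConnectedSpace.joined y z
  -- The boundary point `y` does not move, so the square over `α` reads `α · a ≃ α`, and `α` cancels
  -- in the fundamental groupoid.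
  have hy' : F.evalAt y = Path.refl y := by
    ext t
    exact hF t y hy
  have h := trans_evalAt F α
  rw [hy'] at h
  have h' : (Path.Homotopic.Quotient.mk α).trans (.mk (F.evalAt z))
      = (Path.Homotopic.Quotient.mk α).trans (.refl z) :=
    Quotient.sound ((h.trans ⟨Path.Homotopy.reflTrans α⟩).trans ⟨(Path.Homotopy.transRefl α).symm⟩)
  exact (CategoryTheory.cancel_epi (X := FundamentalGroupoid.mk y) (Y := FundamentalGroupoid.mk z)
    (Path.Homotopic.Quotient.mk α : FundamentalGroupoid.mk y ⟶ FundamentalGroupoid.mk z)).1 h'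

end PointPushingMap

end PointPushing

end

theorem proposition7p1 (d : ℕ) [NeZero d] (hd : 3 ≤ d) {M : Type*} [TopologicalSpace M]
    [ChartedSpace (EuclideanHalfSpace d) M] [IsManifold (𝓡∂ d) ∞ M]
    [T2Space M] [SecondCountableTopology M] [ConnectedSpace M]
    (z : M) (hz : z ∈ (𝓡∂ d).interior M) :
    (PointPushing.KernelCentral (𝓡∂ d) (M ≃ₘ⟮𝓡∂ d, 𝓡∂ d⟯ M) z ∧
      PointPushing.KernelCentral (𝓡∂ d) (M ≃ₜ M) z ∧
      PointPushing.KernelCentral (𝓡∂ d) (PointPushing.HAut M) z) ∧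
    (((𝓡∂ d).boundary M).Nonempty →
      PointPushing.BoundaryInjective (𝓡∂ d) (M ≃ₘ⟮𝓡∂ d, 𝓡∂ d⟯ M) z ∧
      PointPushing.BoundaryInjective (𝓡∂ d) (M ≃ₜ M) z ∧
      PointPushing.BoundaryInjective (𝓡∂ d) (PointPushing.HAut M) z) := by

  have hE : (∅ : Set M) ⊆ (𝓡∂ d).boundary M := Set.empty_subset _
  have : LocallyCompactSpace M := Manifold.locallyCompact_of_finiteDimensional (𝓡∂ d)
  have : LocallyPathConnectedSpace M :=
    ChartedSpace.locallyPathConnectedSpace (EuclideanHalfSpace d) M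
  have : PathConnectedSpace M := pathConnectedSpace_iff_connectedSpace.2 inferInstance
  have := PointPushing.continuousSMul_diff (I := 𝓡∂ d) (M := M)
  have := PointPushing.continuousSMul_homeo (M := M)
  have := PointPushing.continuousSMul_hAut (M := M)
  exact ⟨⟨PointPushing.kernelCentral hz (PointPushing.hasLocalPush_diff hE),
      PointPushing.kernelCentral hz (PointPushing.hasLocalPush_homeo hE),
      PointPushing.kernelCentral hz (PointPushing.hasLocalPush_hAut hE)⟩,
    fun hne => ⟨PointPushing.boundaryInjective hz hne (PointPushing.hasLocalPush_diff subset_rfl),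
      PointPushing.boundaryInjective hz hne (PointPushing.hasLocalPush_homeo subset_rfl),
      PointPushing.boundaryInjective hz hne (PointPushing.hasLocalPush_hAut subset_rfl)⟩⟩
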